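/- Let $n\ge 0$ be an integer, $\mathcal V=\{1,\dots,n\}$, $\mathcal E\subseteq\mathcal V\times\mathcal V$ (self-loops allowed), $\gamma_1,\dots,\gamma_n\in\mathbb R$ and, for every $(j,i)\in\mathcal E$, let $a_{ij}\in\mathbb R$. Consider the network system $$\dot x_i(t)=\gamma_i x_i(t)+\sum_{j:(j,i)\in\mathcal E}a_{ij}x_j(t)+u_i(t),\qquad i=1,\dots,n,$$ with interconnection graph $\mathcal G=(\mathcal V,\mathcal E)$. Put $\Gamma=\mathrm{diag}(\gamma_1,\dots,\gamma_n)$ and let $A\in\mathbb R^{n\times n}$ have entries $[A]_{ij}=a_{ij}$ if $(j,i)\in\mathcal E$ and $[A]_{ij}=0$ otherwise. Let $$\overline W(s)=(sI-\Gamma)(sI-\Gamma-A)^{-1}\in\mathbb R(s)^{n\times n}.$$ For a rational matrix $G(s)$, a point $p\in\mathbb C\cup\{\infty\}$ is a pole of $G$ if it is a pole of at least one entry of $G$ (an entry has a pole at $\infty$ if it is not proper); the degree $\delta(G;p)$ of a pole $p$ is the largest multiplicity that $p$ has as a pole over all minors of $G$; and the McMillan degree $\delta_M(G)$ is the sum of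 $\delta(G;p)$ over the distinct poles $p$ of $G$. The complexity index of the network system is $\varphi=\delta_M(\overline W)$. Then $0\le\varphi\le n$. Moreover, if $a_{ij}\neq 0$ for every edge $(j,i)\in\mathcal E$, then $\varphi=0$ if and only if $\mathcal E=\emptyset$. -/

import Mathlib

noncomputable section

/-! ### Poles of rational matrices and the McMillan degree

Elements of `RatFunc ℝ` are rational functions in the indeterminate `s = RatFunc.X`, and the points
of `ℂ ∪ {∞}` are the elements of `OnePoint ℂ`. -/

/-- The multiplicity of a point of `ℂ ∪ {∞}` as a pole of a rational function `f` (it is `0` where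
`f` has no pole). At `∞` it is the excess of the degree of the numerator over that of the
denominator. -/
def poleMultiplicity (f : RatFunc ℝ) : OnePoint ℂ → ℕ
  | none => f.num.natDegree - f.denom.natDegree
  | some z => (f.denom.map (algebraMap ℝ ℂ)).rootMultiplicity z

/-- A point of `ℂ ∪ {∞}` is a pole of a rational matrix if it is a pole of at least one entry. -/
def IsPole {q m : ℕ} (G : Matrix (Fin q) (Fin m) (RatFunc ℝ)) (p : OnePoint ℂ) : Prop :=
  ∃ i j, 0 < poleMultiplicity (G i j) p

/-- A rational matrix has finitely many poles. -/
theorem finite_setOf_isPole {q m : ℕ} (G : Matrix (Fin q) (Fin m) (RatFunc ℝ)) :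
    {p : OnePoint ℂ | IsPole G p}.Finite := by
  have hsub : {p : OnePoint ℂ | IsPole G p} ⊆
      ⋃ i : Fin q, ⋃ j : Fin m, {p : OnePoint ℂ | 0 < poleMultiplicity (G i j) p} := by
    rintro p ⟨i, j, h⟩
    exact Set.mem_iUnion.2 ⟨i, Set.mem_iUnion.2 ⟨j, h⟩⟩
  refine Set.Finite.subset (Set.finite_iUnion fun i => Set.finite_iUnion fun j => ?_) hsub
  have hne : (G i j).denom.map (algebraMap ℝ ℂ) ≠ 0 :=
    Polynomial.map_ne_zero (G i j).denom_ne_zero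
  refine Set.Finite.subset
    ((((G i j).denom.map (algebraMap ℝ ℂ)).roots.toFinset.finite_toSet.image some).insert none) ?_
  rintro (_ | z) hz
  · exact Set.mem_insert _ _
  · refine Set.mem_insert_of_mem _ ⟨z, ?_, rfl⟩
    have hz' : 0 < ((G i j).denom.map (algebraMap ℝ ℂ)).rootMultiplicity z := hz
    rw [Finset.mem_coe, Multiset.mem_toFinset, Polynomial.mem_roots hne]
    exact (Polynomial.rootMultiplicity_pos hne).1 hz'

/-- The degree of `p` as a pole of `G`: the largest multiplicity that `p` has as a pole over all
minors of `G`. A `k × k` minor is the determinant of the submatrix given by `k` distinct rows and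
`k` distinct columns; the order in which they are listed affects only its sign. -/
def poleDegree {q m : ℕ} (G : Matrix (Fin q) (Fin m) (RatFunc ℝ)) (p : OnePoint ℂ) : ℕ :=
  Finset.univ.sup fun x : Σ k : Fin (q + 1), (Fin k ↪ Fin q) × (Fin k ↪ Fin m) =>
    poleMultiplicity (G.submatrix x.2.1 x.2.2).det p

/-- The McMillan degree: the sum of the degrees of the distinct poles in `ℂ ∪ {∞}`. -/
def mcMillanDegree {q m : ℕ} (G : Matrix (Fin q) (Fin m) (RatFunc ℝ)) : ℕ :=
  ∑ p ∈ (finite_setOf_isPole G).toFinset, poleDegree G p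

/-! ### Network systems -/

/-- A network of `n` first-order linear nodes with dynamics
`ẋᵢ = γᵢ xᵢ + ∑_{j : (j, i) ∈ E} aᵢⱼ xⱼ + uᵢ`. The pair `(j, i)` is the edge from `j` to `i`;
the values `a i j` with `(j, i) ∉ E` are never used. -/
structure NetworkSystem (n : ℕ) where
  /-- the edge set of the interconnection graph -/
  E : Set (Fin n × Fin n)
  /-- the coefficients of the nodal dynamics -/
  γ : Fin n → ℝ
  /-- the interconnection weights -/
  a : Fin n → Fin n → ℝ

namespace NetworkSystem

variable {n : ℕ} (N : NetworkSystem n)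

open Classical in
/-- The weighted interconnection matrix `A`. -/
def A : Matrix (Fin n) (Fin n) ℝ :=
  Matrix.of fun i j => if (j, i) ∈ N.E then N.a i j else 0

/-- `Γ = diag(γ₁, …, γₙ)`. -/
def Γ : Matrix (Fin n) (Fin n) ℝ := Matrix.diagonal N.γ

/-- The transfer function `W(s) = (sI - Γ - A)⁻¹` from the input `u` to the state `x` of
`ẋ = (Γ + A) x + u`. -/
def W : Matrix (Fin n) (Fin n) (RatFunc ℝ) :=
  ((RatFunc.X : RatFunc ℝ) • (1 : Matrix (Fin n) (Fin n) (RatFunc ℝ))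
    - N.Γ.map RatFunc.C - N.A.map RatFunc.C)⁻¹

/-- The local inverse filter `F(s) = sI - Γ`. -/
def F : Matrix (Fin n) (Fin n) (RatFunc ℝ) :=
  (RatFunc.X : RatFunc ℝ) • (1 : Matrix (Fin n) (Fin n) (RatFunc ℝ)) - N.Γ.map RatFunc.C

/-- The filtered transfer function `F(s) W(s)`. -/
def filteredW : Matrix (Fin n) (Fin n) (RatFunc ℝ) := N.F * N.W

/-- The complexity index: the McMillan degree of the filtered transfer function. -/
def complexityIndex : ℕ := mcMillanDegree N.filteredW

/-- The matrix `sI - Γ - A` is invertible over `ℝ(s)`, so that `W` is a genuine inverse. -/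
theorem isUnit_det_resolvent :
    IsUnit ((RatFunc.X : RatFunc ℝ) • (1 : Matrix (Fin n) (Fin n) (RatFunc ℝ))
      - N.Γ.map RatFunc.C - N.A.map RatFunc.C).det := by
  have h : (RatFunc.X : RatFunc ℝ) • (1 : Matrix (Fin n) (Fin n) (RatFunc ℝ))
      - N.Γ.map RatFunc.C - N.A.map RatFunc.C =
      (algebraMap (Polynomial ℝ) (RatFunc ℝ)).mapMatrix (N.Γ + N.A).charmatrix := by
    ext i j
    by_cases hij : i = j
    · subst hij
      simp [Matrix.charmatrix_apply_eq, RatFunc.algebraMap_C]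
      ring
    · simp [RatFunc.algebraMap_C, hij]
      ring
  rw [h, ← RingHom.map_det, isUnit_iff_ne_zero]
  exact (map_ne_zero_iff _ (RatFunc.algebraMap_injective ℝ)).2
    (N.Γ + N.A).charpoly_monic.ne_zero

end NetworkSystem

end

/-! Put `P = sI - Γ - A`. Since `F = P + A`, the filtered transfer function is `1 + A P⁻¹`. By a
Schur complement, `det P` times any of its minors is the determinant of a polynomial block matrix
with `n` rows of degree at most 1 and all other rows constant (`exists_charpoly_mul_minor_eq`). So
every minor is a proper fraction over the characteristic polynomial of `Γ + A`: there is no pole at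
`∞`, and the finite pole degrees sum to at most `n` (`mcMillanDegree_le_natDegree`).

If the index vanishes, no entry has a pole, so `F W` is a real matrix `M`; comparing coefficients of
`s` in `(M - 1) F = M A` gives `M = 1`, hence `A = 0`. Conversely `A = 0` gives `F W = 1`, and
nonzero weights make `A = 0` the same as having no edges. -/

open Polynomial in
/-- A square matrix over `ℝ[X]` whose rows have degrees at most `d` has a determinant of degree at
most the sum of the `d i`. -/
theorem Matrix.natDegree_det_le_sum_rows {R ι : Type*} [CommRing R] [Fintype ι] [DecidableEq ι]
    (M : Matrix ι ι R[X]) (d : ι → ℕ) (h : ∀ i j, (M i j).natDegree ≤ d i) :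
    M.det.natDegree ≤ ∑ i, d i := by
  rw [Matrix.det_apply]
  refine natDegree_sum_le_of_forall_le _ _ fun σ _ => ?_
  refine (natDegree_smul_le _ _).trans ((natDegree_prod_le _ _).trans ?_)
  rw [← Equiv.sum_comp σ d]
  exact Finset.sum_le_sum fun i _ => h _ _

open Polynomial in
theorem RatFunc.num_mul_eq_mul_denom_of_mul_eq {K : Type*} [Field K] {f : RatFunc K} {p q : K[X]}
    (h : algebraMap K[X] (RatFunc K) p * f = algebraMap K[X] (RatFunc K) q) :
    p * f.num = q * f.denom := by
  have hd : algebraMap K[X] (RatFunc K) f.denom ≠ 0 :=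
    RatFunc.algebraMap_ne_zero f.denom_ne_zero
  apply RatFunc.algebraMap_injective K
  rw [map_mul, map_mul, ← h, mul_assoc]
  congr 1
  exact (div_eq_iff hd).1 (RatFunc.num_div_denom f)

open Polynomial in
theorem poleMultiplicity_none_eq_zero_of_mul_eq {f : RatFunc ℝ} {p q : ℝ[X]} (hp : p ≠ 0)
    (h : algebraMap ℝ[X] (RatFunc ℝ) p * f = algebraMap ℝ[X] (RatFunc ℝ) q)
    (hqp : q.natDegree ≤ p.natDegree) : poleMultiplicity f none = 0 := by
  have e := RatFunc.num_mul_eq_mul_denom_of_mul_eq h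
  change f.num.natDegree - f.denom.natDegree = 0
  by_cases hf : f.num = 0
  · simp [hf]
  have hq : q ≠ 0 := by
    rintro rfl
    simp [hp, hf] at e
  have e' := congrArg natDegree e
  rw [natDegree_mul hp hf, natDegree_mul hq f.denom_ne_zero] at e'
  omega

-- By coprimality with the numerator, the reduced denominator of `f` divides `p`.
open Polynomial in
theorem poleMultiplicity_some_le_of_mul_eq {f : RatFunc ℝ} {p q : ℝ[X]} (hp : p ≠ 0)
    (h : algebraMap ℝ[X] (RatFunc ℝ) p * f = algebraMap ℝ[X] (RatFunc ℝ) q) (z : ℂ) :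
    poleMultiplicity f (some z) ≤ (p.map (algebraMap ℝ ℂ)).rootMultiplicity z := by
  have hdvd : f.denom ∣ p :=
    f.isCoprime_num_denom.symm.dvd_of_dvd_mul_right
      ⟨q, by rw [RatFunc.num_mul_eq_mul_denom_of_mul_eq h, mul_comm]⟩
  exact rootMultiplicity_le_rootMultiplicity_of_dvd (Polynomial.map_ne_zero hp)
    (Polynomial.map_dvd _ hdvd) z

/-- A rational function without poles in `ℂ ∪ {∞}` is constant. -/
theorem exists_eq_C_of_poleMultiplicity_eq_zero {f : RatFunc ℝ}
    (h : ∀ p, poleMultiplicity f p = 0) : ∃ c : ℝ, f = RatFunc.C c := by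
  have hdeg : f.denom.natDegree = 0 := by
    rw [← Polynomial.natDegree_map (algebraMap ℝ ℂ)]
    by_contra hne
    obtain ⟨z, hz⟩ := IsAlgClosed.exists_root (f.denom.map (algebraMap ℝ ℂ))
      (fun h0 => hne (Polynomial.natDegree_eq_of_degree_eq_some h0))
    have := (Polynomial.rootMultiplicity_pos
      (Polynomial.map_ne_zero (f := algebraMap ℝ ℂ) f.denom_ne_zero)).2 hz
    exact this.ne' (h (some z))
  have hnum : f.num.natDegree = 0 := by
    have h0 : f.num.natDegree - f.denom.natDegree = 0 := h none
    omega
  have hden : f.denom = 1 := f.monic_denom.natDegree_eq_zero.1 hdeg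
  refine ⟨f.num.coeff 0, ?_⟩
  conv_lhs => rw [← RatFunc.num_div_denom f, hden, Polynomial.eq_C_of_natDegree_eq_zero hnum]
  simp [RatFunc.algebraMap_C]

theorem poleDegree_le {q m : ℕ} {G : Matrix (Fin q) (Fin m) (RatFunc ℝ)} {p : OnePoint ℂ} {b : ℕ}
    (h : ∀ (k : ℕ) (r : Fin k → Fin q) (c : Fin k → Fin m),
      poleMultiplicity (G.submatrix r c).det p ≤ b) : poleDegree G p ≤ b :=
  Finset.sup_le fun x _ => h _ x.2.1 x.2.2

theorem poleMultiplicity_le_poleDegree {q m : ℕ} (G : Matrix (Fin q) (Fin m) (RatFunc ℝ))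
    (p : OnePoint ℂ) (i : Fin q) (j : Fin m) : poleMultiplicity (G i j) p ≤ poleDegree G p := by
  -- An entry is a 1 × 1 minor; the index `i` shows that `q` is positive, so this size is allowed.
  have hq : 1 < q + 1 := by have := i.pos; omega
  have := Finset.le_sup (Finset.mem_univ
    (⟨⟨1, hq⟩, ⟨fun _ => i, Function.injective_of_subsingleton _⟩,
      ⟨fun _ => j, Function.injective_of_subsingleton _⟩⟩ :
      Σ k : Fin (q + 1), (Fin k ↪ Fin q) × (Fin k ↪ Fin m)))
    (f := fun x => poleMultiplicity (G.submatrix x.2.1 x.2.2).det p)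
  refine le_trans (le_of_eq ?_) this
  change _ = poleMultiplicity (Matrix.det (n := Fin 1) _) p
  rw [Matrix.det_fin_one]
  rfl

theorem poleMultiplicity_eq_zero_of_mcMillanDegree_eq_zero {q m : ℕ}
    {G : Matrix (Fin q) (Fin m) (RatFunc ℝ)} (h : mcMillanDegree G = 0) (p : OnePoint ℂ)
    (i : Fin q) (j : Fin m) : poleMultiplicity (G i j) p = 0 := by
  by_contra hne
  have hp : p ∈ (finite_setOf_isPole G).toFinset := by
    rw [Set.Finite.mem_toFinset]
    exact ⟨i, j, Nat.pos_of_ne_zero hne⟩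
  have := Finset.sum_eq_zero_iff.1 h p hp
  have := poleMultiplicity_le_poleDegree G p i j
  omega

open Polynomial in
/-- If `p` is a common denominator of all minors of `G` and the minors are proper, then the McMillan
degree of `G` is at most the degree of `p`. -/
theorem mcMillanDegree_le_natDegree {q m : ℕ} {G : Matrix (Fin q) (Fin m) (RatFunc ℝ)} {p : ℝ[X]}
    (hp : p ≠ 0)
    (h : ∀ (k : ℕ) (r : Fin k → Fin q) (c : Fin k → Fin m), ∃ u : ℝ[X],
      u.natDegree ≤ p.natDegree ∧
      algebraMap ℝ[X] (RatFunc ℝ) p * (G.submatrix r c).det = algebraMap ℝ[X] (RatFunc ℝ) u) :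
    mcMillanDegree G ≤ p.natDegree := by
  classical
  set P := p.map (algebraMap ℝ ℂ) with hP
  have hsome : ∀ (z : ℂ) (k : ℕ) (r : Fin k → Fin q) (c : Fin k → Fin m),
      poleMultiplicity (G.submatrix r c).det (some z) ≤ P.roots.count z := by
    intro z k r c
    obtain ⟨u, -, hu⟩ := h k r c
    rw [count_roots]
    exact poleMultiplicity_some_le_of_mul_eq hp hu z
  -- Entries are 1 × 1 minors: properness excludes `∞`, and finite poles are roots of `P`.
  have hpoles : (finite_setOf_isPole G).toFinset ⊆ P.roots.toFinset.map Function.Embedding.some := by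
    intro x hx
    rw [Set.Finite.mem_toFinset] at hx
    obtain ⟨i, j, hx⟩ := hx
    have hent : G i j = (G.submatrix (fun _ : Fin 1 => i) (fun _ : Fin 1 => j)).det := by simp
    rw [hent] at hx
    rcases x with _ | z
    · obtain ⟨u, hdeg, hu⟩ := h 1 (fun _ => i) (fun _ => j)
      exact absurd (poleMultiplicity_none_eq_zero_of_mul_eq hp hu hdeg) hx.ne'
    · refine Finset.mem_map.2 ⟨z, ?_, rfl⟩
      rw [Multiset.mem_toFinset, ← Multiset.count_pos]
      exact hx.trans_le (hsome z _ _ _)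
  calc mcMillanDegree G
      ≤ ∑ x ∈ P.roots.toFinset.map Function.Embedding.some, poleDegree G x :=
        Finset.sum_le_sum_of_subset hpoles
    _ = ∑ z ∈ P.roots.toFinset, poleDegree G (some z) := Finset.sum_map _ _ _
    _ ≤ ∑ z ∈ P.roots.toFinset, P.roots.count z :=
        Finset.sum_le_sum fun z _ => poleDegree_le (hsome z)
    _ = P.roots.card := Multiset.toFinset_sum_count_eq _
    _ ≤ P.natDegree := card_roots' _
    _ = p.natDegree := natDegree_map _

/-- All minors are real constants, so 1 serves as common denominator. -/
theorem mcMillanDegree_one (n : ℕ) :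
    mcMillanDegree (1 : Matrix (Fin n) (Fin n) (RatFunc ℝ)) = 0 := by
  have h : mcMillanDegree (1 : Matrix (Fin n) (Fin n) (RatFunc ℝ)) ≤
      (1 : Polynomial ℝ).natDegree := by
    refine mcMillanDegree_le_natDegree one_ne_zero fun k r c => ?_
    refine ⟨Polynomial.C ((1 : Matrix (Fin n) (Fin n) ℝ).submatrix r c).det, by simp, ?_⟩
    rw [map_one, one_mul, RatFunc.algebraMap_C, RingHom.map_det]
    congr 1
    ext i j
    simp [Matrix.one_apply, apply_ite]
  simpa using h

namespace NetworkSystem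

variable {n : ℕ} (N : NetworkSystem n)

theorem F_sub_A_eq_charmatrix :
    N.F - N.A.map RatFunc.C =
      (N.Γ + N.A).charmatrix.map (algebraMap (Polynomial ℝ) (RatFunc ℝ)) := by
  ext i j
  by_cases hij : i = j
  · subst hij
    simp [F, Matrix.charmatrix_apply_eq, RatFunc.algebraMap_C]
    ring
  · simp [F, RatFunc.algebraMap_C, hij]
    ring

theorem isUnit_det_F_sub_A : IsUnit (N.F - N.A.map RatFunc.C).det :=
  N.isUnit_det_resolvent

theorem isUnit_F_sub_A : IsUnit (N.F - N.A.map RatFunc.C) :=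
  (Matrix.isUnit_iff_isUnit_det _).2 N.isUnit_det_F_sub_A

theorem filteredW_mul : N.filteredW * (N.F - N.A.map RatFunc.C) = N.F := by
  have : N.W = (N.F - N.A.map RatFunc.C)⁻¹ := rfl
  rw [filteredW, this, Matrix.mul_assoc, Matrix.nonsing_inv_mul _ N.isUnit_det_F_sub_A,
    Matrix.mul_one]

theorem filteredW_eq_one_add :
    N.filteredW = 1 + N.A.map RatFunc.C * (N.F - N.A.map RatFunc.C)⁻¹ := by
  refine N.isUnit_F_sub_A.mul_right_cancel ?_
  rw [filteredW_mul, Matrix.add_mul, Matrix.mul_assoc,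
    Matrix.nonsing_inv_mul _ N.isUnit_det_F_sub_A]
  simp

open Polynomial in
/-- Every minor of `F(s) W(s)` is a proper fraction over the characteristic polynomial of
`Γ + A`, by the Schur complement formula. -/
theorem exists_charpoly_mul_minor_eq (k : ℕ) (r c : Fin k → Fin n) :
    ∃ u : ℝ[X], u.natDegree ≤ (N.Γ + N.A).charpoly.natDegree ∧
      algebraMap ℝ[X] (RatFunc ℝ) (N.Γ + N.A).charpoly * (N.filteredW.submatrix r c).det =
        algebraMap ℝ[X] (RatFunc ℝ) u := by
  -- The Schur complement of the upper left block is the `(r, c)` submatrix of `1 + A P⁻¹`.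
  let M : Matrix (Fin n ⊕ Fin k) (Fin n ⊕ Fin k) ℝ[X] :=
    Matrix.fromBlocks (N.Γ + N.A).charmatrix ((1 : Matrix (Fin n) (Fin n) ℝ[X]).submatrix id c)
      (-(N.A.map Polynomial.C).submatrix r id) ((1 : Matrix (Fin n) (Fin n) ℝ[X]).submatrix r c)
  have hone : ∀ i j : Fin n, ((1 : Matrix (Fin n) (Fin n) ℝ[X]) i j).natDegree = 0 := by
    intro i j
    rw [Matrix.one_apply]
    split_ifs <;> simp
  refine ⟨M.det, ?_, ?_⟩
  · refine (M.natDegree_det_le_sum_rows (Sum.elim (fun _ => 1) (fun _ => 0)) ?_).trans ?_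
    · rintro (i | i) (j | j)
      · exact (Matrix.charmatrix_apply_natDegree_le i j).trans (by split_ifs <;> simp)
      · simp [M, hone]
      · simp [M]
      · simp [M, hone]
    · simp [Matrix.charpoly_natDegree_eq_dim]
  · let P := N.F - N.A.map RatFunc.C
    have hPu : IsUnit P := N.isUnit_F_sub_A
    let : Invertible P := hPu.invertible
    have hM : M.map (algebraMap ℝ[X] (RatFunc ℝ)) =
        Matrix.fromBlocks P ((1 : Matrix (Fin n) (Fin n) (RatFunc ℝ)).submatrix id c)
          (-(N.A.map RatFunc.C).submatrix r id)
          ((1 : Matrix (Fin n) (Fin n) (RatFunc ℝ)).submatrix r c) := by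
      rw [Matrix.fromBlocks_map]
      congr 1
      · exact N.F_sub_A_eq_charmatrix.symm
      · ext i j
        simp [Matrix.one_apply, apply_ite]
      · ext i j
        simp [RatFunc.algebraMap_C]
      · ext i j
        simp [Matrix.one_apply, apply_ite]
    have hdetP : P.det = algebraMap ℝ[X] (RatFunc ℝ) (N.Γ + N.A).charpoly := by
      rw [Matrix.charpoly, RingHom.map_det]
      exact congrArg Matrix.det N.F_sub_A_eq_charmatrix
    rw [RingHom.map_det, RingHom.mapMatrix_apply, hM, Matrix.det_fromBlocks₁₁, hdetP]
    congr 2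
    rw [filteredW_eq_one_add, Matrix.invOf_eq_nonsing_inv, Matrix.neg_mul, Matrix.neg_mul,
      sub_neg_eq_add]
    ext i j
    simp [Matrix.mul_apply, Matrix.one_apply, P]

theorem complexityIndex_le : N.complexityIndex ≤ n :=
  (mcMillanDegree_le_natDegree (N.Γ + N.A).charpoly_monic.ne_zero
    N.exists_charpoly_mul_minor_eq).trans_eq (by simp [Matrix.charpoly_natDegree_eq_dim])

theorem complexityIndex_eq_zero_of_A_eq_zero (h : N.A = 0) : N.complexityIndex = 0 := by
  rw [complexityIndex, filteredW_eq_one_add, h]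
  simpa using mcMillanDegree_one n

theorem A_eq_zero_of_complexityIndex_eq_zero (h : N.complexityIndex = 0) : N.A = 0 := by
  choose M hM using fun i j => exists_eq_C_of_poleMultiplicity_eq_zero fun p =>
    poleMultiplicity_eq_zero_of_mcMillanDegree_eq_zero h p i j
  have key : (N.filteredW - 1) * N.F = N.filteredW * N.A.map RatFunc.C := by
    have := N.filteredW_mul
    rw [Matrix.mul_sub, sub_eq_iff_eq_add] at this
    rw [Matrix.sub_mul, this]
    simp
  have hent : ∀ i j, (M i j - (1 : Matrix (Fin n) (Fin n) ℝ) i j) = 0 := by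
    intro i j
    have e := congrFun (congrFun key i) j
    have hF : N.F = Matrix.diagonal fun j => RatFunc.X - RatFunc.C (N.γ j) := by
      ext a b
      by_cases hab : a = b
      · subst hab; simp [F, Γ]
      · simp [F, Γ, hab]
    have e' : (Polynomial.C (M i j - (1 : Matrix (Fin n) (Fin n) ℝ) i j)) *
        (Polynomial.X - Polynomial.C (N.γ j)) =
        Polynomial.C (∑ k, M i k * N.A k j) := by
      apply RatFunc.algebraMap_injective ℝ
      rw [hF, Matrix.mul_diagonal, Matrix.mul_apply] at e
      simp only [hM, Matrix.sub_apply, Matrix.map_apply] at e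
      simp only [map_mul, map_sub, RatFunc.algebraMap_C, RatFunc.algebraMap_X, map_sum]
      rw [← e]
      congr 2
      simp [Matrix.one_apply, apply_ite]
    -- The right side is constant, so the coefficient of `X` on the left vanishes.
    have hc := congrArg (fun p => Polynomial.coeff p 1) e'
    simpa only [Polynomial.coeff_C_mul, Polynomial.coeff_sub, Polynomial.coeff_X_one,
      Polynomial.coeff_C_succ, sub_zero, mul_one] using hc
  have hW : N.filteredW = 1 := by
    ext i j
    rw [hM, sub_eq_zero.1 (hent i j)]
    simp [Matrix.one_apply, apply_ite]
  -- With `F W = 1`, the identity `key` reads `0 = A`.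
  rw [hW, sub_self, Matrix.zero_mul, Matrix.one_mul] at key
  ext i j
  have e := congrFun (congrFun key i) j
  simpa using e.symm

theorem A_eq_zero_iff (h : ∀ i j : Fin n, (j, i) ∈ N.E → N.a i j ≠ 0) :
    N.A = 0 ↔ N.E = ∅ := by
  constructor
  · intro hA
    refine Set.eq_empty_of_forall_notMem fun ⟨j, i⟩ hji => h i j hji ?_
    simpa [A, hji] using congrFun (congrFun hA i) j
  · intro hE
    ext i j
    simp [A, hE]

end NetworkSystem

theorem mainTheorem4 {n : ℕ} (N : NetworkSystem n) :
    (0 ≤ N.complexityIndex ∧ N.complexityIndex ≤ n) ∧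
      ((∀ i j : Fin n, (j, i) ∈ N.E → N.a i j ≠ 0) →
        (N.complexityIndex = 0 ↔ N.E = ∅)) := by
  refine ⟨⟨Nat.zero_le _, N.complexityIndex_le⟩, fun h => ?_⟩
  rw [← N.A_eq_zero_iff h]
  exact ⟨N.A_eq_zero_of_complexityIndex_eq_zero, N.complexityIndex_eq_zero_of_A_eq_zero⟩
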